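/- There are an integer $D$, an integer $k\ge 0$, a real $c>0$ and, for every $n\ge 1$, a connected unweighted graph $G_n$ with $n$ vertices and diameter at most $D$, such that the following holds. Let $1\le p\le\infty$ and let $d:\mathbb N\to\mathbb N$ satisfy $d(n)=o(n/\log n)$ if $p<\infty$, or $d(n)=o(\log n)$ if $p=\infty$. Then for all sufficiently large $n$ (depending on $p$ and $d$ only) and every consistent heuristic $h$ on $G_n$ of the form $h(s,t)=\|\pi(s)-\pi(t)\|_p$ with $\pi:V(G_n)\to\mathbb R^{d(n)}$, the A* algorithm with heuristic $h$, however it breaks ties, satisfies $$\frac1{n^2}\sum_{s,t\in V(G_n)}|S_h(s,t)|\ \ge\ c\,\frac{n}{(\log n)^k},$$ that is, it scans $\tilde\Omega(n)$ vertices on average over independent uniformly random $s,t$. Here $h$ is consistent if $h(t,t)=0$ for every vertex $t$ and $1+h(v,t)-h(u,t)\ge 0$ for every $t$ and every ordered pair $(u,v)$ of adjacent vertices. A* with source $s$ and target $t$ starts with no vertex scanned, $d(s)=0$ and $d(v)=\infty$ for $v\ne s$ (tentative distances); as long as $t$ is not scanned, it picks an unscanned vertex $u$ minimizing $d(u)+h(u,t)$,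 sets $d(v)\leftarrow\min(d(v),d(u)+1)$ for all neighbours $v$ of $u$, and marks $u$ as scanned. $S_h(s,t)$ is the set of vertices that are scanned when it stops (it contains $s$ and $t$). -/

import Mathlib

open Filter Asymptotics
open scoped ENNReal

/-- A heuristic `h` is consistent on the unweighted graph `G` (all edges have length `1`) if, for
every destination `t`, every edge `(u, v)` has non-negative modified cost
`1 + h(v, t) - h(u, t)`, and `h(t, t) = 0`. -/
def IsConsistent {V : Type*} (G : SimpleGraph V) (h : V → V → ℝ) : Prop :=
  ∀ t : V, h t t = 0 ∧ ∀ u v : V, G.Adj u v → 0 ≤ 1 + h v t - h u t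

/-- `h` is a norm heuristic of dimension `d` induced by the `ℓ_p` norm:
`h(s, t) = ‖π(s) - π(t)‖_p` for some `π : V → ℝ^d`. -/
def IsNormHeuristic {V : Type*} (p : ℝ≥0∞) (d : ℕ) (h : V → V → ℝ) : Prop :=
  ∃ π : V → PiLp p (fun _ : Fin d => ℝ), ∀ s t : V, h s t = ‖π s - π t‖

namespace AStar

/-- The state of the A* search: the set of scanned vertices, and the tentative distances from the
source (`⊤` for vertices that have not been reached). -/
structure State (V : Type*) where
  scanned : Finset V
  tent : V → ℕ∞

/-- The initial state: nothing is scanned, and only the source has a finite tentative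
distance, so the source is necessarily the first vertex to be scanned. -/
def init {V : Type*} [DecidableEq V] (s : V) : State V where
  scanned := ∅
  tent := fun v => if v = s then 0 else ⊤

/-- The priority `d(u) + h(u, t)` of a vertex `u` with tentative distance `d(u)`. -/
noncomputable def key {V : Type*} (h : V → V → ℝ) (t : V) (σ : State V) (u : V) : WithTop ℝ :=
  WithTop.map (fun k : ℕ => (k : ℝ) + h u t) (σ.tent u)

open Classical in
/-- Relaxing the edges at `u`: `d(v) ← min(d(v), d(u) + 1)` for every neighbour `v` of `u`. -/
noncomputable def relax {V : Type*} (G : SimpleGraph V) (u : V) (tent : V → ℕ∞) : V → ℕ∞ :=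
  fun v => if G.Adj u v then min (tent v) (tent u + 1) else tent v

/-- One iteration of the main loop with destination `t`, which is entered only as long as `t` has
not been scanned: some unscanned vertex `u` of minimum priority (ties are broken
arbitrarily) is scanned. -/
def Step {V : Type*} [DecidableEq V] (G : SimpleGraph V) (h : V → V → ℝ) (t : V)
    (σ τ : State V) : Prop :=
  t ∉ σ.scanned ∧ ∃ u, u ∉ σ.scanned ∧ (∀ v, v ∉ σ.scanned → key h t σ u ≤ key h t σ v) ∧
    τ.scanned = insert u σ.scanned ∧ τ.tent = relax G u σ.tent

/-- `S` is the set of vertices scanned by some complete run of A* from `s` to `t` (for some way of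
breaking ties). Both `s` and `t` belong to it. -/
def IsScannedSet {V : Type*} [DecidableEq V] (G : SimpleGraph V) (h : V → V → ℝ) (s t : V)
    (S : Finset V) : Prop :=
  ∃ σ : State V, Relation.ReflTransGen (Step G h t) (init s) σ ∧ t ∈ σ.scanned ∧ σ.scanned = S

end AStar

/-- The average of `|S(s, t)|` over a pair `(s, t)` of vertices chosen independently and uniformly
at random. -/
noncomputable def averageCard {V : Type*} [Fintype V] (S : V → V → Finset V) : ℝ :=
  (∑ s : V, ∑ t : V, ((S s t).card : ℝ)) / (Fintype.card V : ℝ) ^ 2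

/-! `G_n` is a blow-up: each vertex of `pendantMultipartite q`, with `q ≈ log n`, becomes a class of
at least `m ≈ n / (6q)` independent twins. Take `s` in the pendant class at `(i, a)`, `t` in the
core class `(i, b)` with `b ≠ a`, and `u` in the core class `(i, a)`. Then `s` and `t` are at
distance `3`, `u` and `t` at distance `2`, and `u` is adjacent to `s`. A* settles every neighbour
`u` of `s` with `1 + h(u, t) < 3`, so each pair `(u, t)` with `h(u, t) < 2` costs one scan for each
of the `m` or more sources `s`.

It remains to find about `m²` such underestimated pairs between two classes of one part. If some
part has no exact pair (`h ≥ 2`) between its first two classes, all pairs there qualify. Otherwise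
every part has an exact pair. For `p = ∞` these `q` pairs need `q` different coordinates,
contradicting `d < q`. For `p < ∞`, an exact pair in one part and one vertex from each class of
another part form a `K_{3,2}`, which has no isometric copy in `ℓ_p`; so every such triple contains
an underestimated pair, and double counting gives `m² / 3` of them between two of the classes. The
total is at least `m³ / 3`, hence `n / (log n)³` on average up to a constant. -/

namespace AStar

/-! ### Invariants of A* runs -/

variable {V : Type*} {G : SimpleGraph V} {h : V → V → ℝ} {s t : V}

theorem Step.scanned_subset [DecidableEq V] {σ τ : State V} (hστ : Step G h t σ τ) : σ.scanned ⊆ τ.scanned := by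
  obtain ⟨-, u, -, -, hu, -⟩ := hστ
  rw [hu]
  exact Finset.subset_insert _ _

/-- A `1`-Lipschitz function that vanishes at the source is a lower bound for all tentative
distances. -/
theorem le_tent [DecidableEq V] {φ : V → ℕ} (hs : φ s = 0) (hφ : ∀ u v, G.Adj u v → φ v ≤ φ u + 1)
    {σ : State V} (hσ : Relation.ReflTransGen (Step G h t) (init s) σ) (v : V) :
    (φ v : ℕ∞) ≤ σ.tent v := by
  induction hσ generalizing v with
  | refl =>
    by_cases hv : v = s
    · simp [hv, hs]
    · simp [init, hv]
  | tail _ hstep ih =>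
    obtain ⟨-, u, -, -, -, hu⟩ := hstep
    rw [hu, relax]
    split_ifs with huv
    · refine le_min (ih v) ?_
      calc (φ v : ℕ∞) ≤ ((φ u + 1 : ℕ) : ℕ∞) := by exact_mod_cast hφ u v huv
        _ = φ u + 1 := by push_cast; rfl
        _ ≤ _ := by gcongr; exact ih u
    · exact ih v

theorem relax_le (u : V) (tent : V → ℕ∞) (v : V) : relax G u tent v ≤ tent v := by
  rw [relax]
  split_ifs
  · exact min_le_left _ _
  · exact le_rfl

theorem tent_source [DecidableEq V] {σ : State V} (hσ : Relation.ReflTransGen (Step G h t) (init s) σ) :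
    σ.tent s = 0 := by
  induction hσ with
  | refl => simp [init]
  | tail _ hstep ih =>
    obtain ⟨-, u, -, -, -, hu⟩ := hstep
    rw [hu, ← nonpos_iff_eq_zero, ← ih]
    exact relax_le u _ s

theorem tent_le_one [DecidableEq V] {σ : State V} (hσ : Relation.ReflTransGen (Step G h t) (init s) σ)
    (hs : s ∈ σ.scanned) {u : V} (hu : G.Adj s u) : σ.tent u ≤ 1 := by
  induction hσ with
  | refl => simp [init] at hs
  | tail hσ hstep ih =>
    obtain ⟨-, w, -, -, hw, hw'⟩ := hstep
    rw [hw']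
    rw [hw, Finset.mem_insert] at hs
    rcases hs with rfl | hs
    · rw [relax, if_pos hu, tent_source hσ]
      exact (min_le_right _ _).trans (by simp)
    · exact (relax_le w _ u).trans (ih hs)

theorem key_of_tent_eq {σ : State V} {v : V} {k : ℕ} (hk : σ.tent v = k) :
    key h t σ v = ((k + h v t : ℝ) : WithTop ℝ) := by
  rw [key, hk]
  rfl

/-- A neighbour `u` of the source `s` with `1 + h(u, t)` smaller than the distance from `s` to `t`
is scanned. -/
theorem mem_of_isScannedSet [DecidableEq V] {S : Finset V} (hS : IsScannedSet G h s t S)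
    (hh : IsConsistent G h) {φ : V → ℕ} (hs : φ s = 0)
    (hφ : ∀ u v, G.Adj u v → φ v ≤ φ u + 1) {u : V} (hu : G.Adj s u)
    (hut : 1 + h u t < φ t) : u ∈ S := by
  obtain ⟨τ, hτ, ht, rfl⟩ := hS
  rcases hτ.cases_tail with rfl | ⟨σ, hσ, hstep⟩
  · simp [init] at ht
  refine hstep.scanned_subset ?_
  obtain ⟨htσ, w, -, hmin, hw, -⟩ := hstep
  obtain rfl : t = w := by
    rw [hw, Finset.mem_insert] at ht
    exact ht.resolve_right htσ
  -- When `t` is about to be scanned, its priority is its tentative distance, as `h(t, t) = 0`.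
  have hle : ((φ t : ℝ) : WithTop ℝ) ≤ key h t σ t := by
    have h1 := le_tent hs hφ hσ t
    rcases eq_or_ne (σ.tent t) ⊤ with hk | hk
    · rw [key, hk]
      exact le_top
    · obtain ⟨k, hk⟩ := ENat.ne_top_iff_exists.mp hk
      rw [key_of_tent_eq hk.symm, (hh t).1, add_zero]
      rw [← hk] at h1
      have h2 : φ t ≤ k := by exact_mod_cast h1
      exact_mod_cast h2
  -- An unscanned vertex of priority below `φ t` would have been preferred to `t`.
  have hmem : ∀ v, ∀ k : ℕ, σ.tent v ≤ k → (k : ℝ) + h v t < φ t → v ∈ σ.scanned := by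
    intro v k hvk hlt
    by_contra hv
    obtain ⟨j, hj⟩ := ENat.ne_top_iff_exists.mp (ne_top_of_le_ne_top (ENat.natCast_ne_top k) hvk)
    have h1 := hle.trans (hmin v hv)
    rw [key_of_tent_eq hj.symm, WithTop.coe_le_coe] at h1
    rw [← hj] at hvk
    have h2 : (j : ℝ) ≤ k := by exact_mod_cast hvk
    linarith
  -- Consistency along the edge `s u` gives `h(s, t) ≤ 1 + h(u, t) < φ t`, so `s` is scanned first,
  -- and then `u` has tentative distance at most `1`.
  have hsσ : s ∈ σ.scanned := by
    refine hmem s 0 (by simp [tent_source hσ]) ?_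
    have := (hh t).2 s u hu
    push_cast
    linarith
  exact hmem u 1 (by simpa using tent_le_one hσ hsσ hu) (by simpa using hut)

end AStar

theorem IsConsistent.le_one_of_adj {V : Type*} {G : SimpleGraph V} {h : V → V → ℝ}
    (hh : IsConsistent G h) {u v : V} (huv : G.Adj u v) : h u v ≤ 1 := by
  have h1 := (hh v).1
  have h2 := (hh v).2 u v huv
  linarith

/-! ### Geometry of `ℓ_p` -/

/-- The pentagonal inequality on the real line. -/
theorem abs_sub_pentagonal (a b c y z : ℝ) :
    |a - b| + |a - c| + |b - c| + |y - z| ≤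
      |a - y| + |b - y| + |c - y| + (|a - z| + |b - z| + |c - z|) := by
  -- Only the left side needs its signs resolved; on the right `±x ≤ |x|` suffices.
  rcases abs_cases (a - b) with h1 | h1 <;> rcases abs_cases (a - c) with h2 | h2 <;>
  rcases abs_cases (b - c) with h3 | h3 <;> rcases abs_cases (y - z) with h4 | h4 <;>
  linarith [le_abs_self (a - y), neg_abs_le (a - y), le_abs_self (b - y), neg_abs_le (b - y),
    le_abs_self (c - y), neg_abs_le (c - y), le_abs_self (a - z), neg_abs_le (a - z),
    le_abs_self (b - z), neg_abs_le (b - z), le_abs_self (c - z), neg_abs_le (c - z)]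

theorem abs_half_add_rpow_le {r : ℝ} (hr : 1 < r) (a b : ℝ) :
    |(a + b) / 2| ^ r ≤ (|a| ^ r + |b| ^ r) / 2 := by
  have h1 := (strictConvexOn_rpow hr).convexOn.2 (Set.mem_Ici.mpr (abs_nonneg a))
    (Set.mem_Ici.mpr (abs_nonneg b)) (by norm_num : (0 : ℝ) ≤ 1 / 2)
    (by norm_num : (0 : ℝ) ≤ 1 / 2) (by norm_num)
  simp only [smul_eq_mul] at h1
  have h2 : |(a + b) / 2| ^ r ≤ (1 / 2 * |a| + 1 / 2 * |b|) ^ r := by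
    refine Real.rpow_le_rpow (abs_nonneg _) ?_ (by linarith)
    rw [abs_div, abs_two]
    linarith [abs_add_le a b]
  linarith

theorem abs_half_add_rpow_lt {r : ℝ} (hr : 1 < r) {a b : ℝ} (hab : a ≠ b) :
    |(a + b) / 2| ^ r < (|a| ^ r + |b| ^ r) / 2 := by
  by_cases habs : |a| = |b|
  -- Convexity on `[0, ∞)` is not strict at `|a| = |b|`, but then the midpoint of `a` and `b` is
  -- `0`.
  · obtain rfl : a = -b := (abs_eq_abs.mp habs).resolve_left hab
    have hb : 0 < |b| := abs_pos.mpr (by rintro rfl; simp at hab)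
    have := Real.rpow_pos_of_pos hb r
    rw [neg_add_cancel, zero_div, abs_zero, Real.zero_rpow (by linarith), abs_neg]
    linarith
  · have h1 := (strictConvexOn_rpow hr).2 (Set.mem_Ici.mpr (abs_nonneg a))
      (Set.mem_Ici.mpr (abs_nonneg b)) habs (by norm_num : (0 : ℝ) < 1 / 2)
      (by norm_num : (0 : ℝ) < 1 / 2) (by norm_num)
    simp only [smul_eq_mul] at h1
    have h2 : |(a + b) / 2| ^ r ≤ (1 / 2 * |a| + 1 / 2 * |b|) ^ r := by
      refine Real.rpow_le_rpow (abs_nonneg _) ?_ (by linarith)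
      rw [abs_div, abs_two]
      linarith [abs_add_le a b]
    linarith

section PiLp

variable {ι : Type*} [Fintype ι] {p : ℝ≥0∞}

theorem PiLp.sum_rpow_le_one (hp : 0 < p.toReal) {x : PiLp p (fun _ : ι => ℝ)} (hx : ‖x‖ ≤ 1) :
    ∑ i, |x i| ^ p.toReal ≤ 1 := by
  have h0 : 0 ≤ ∑ i, ‖x i‖ ^ p.toReal :=
    Finset.sum_nonneg fun i _ => Real.rpow_nonneg (norm_nonneg _) _
  rw [PiLp.norm_eq_sum hp] at hx
  simp only [← Real.norm_eq_abs]
  by_contra! hlt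
  exact absurd hx (not_le.mpr (Real.one_lt_rpow hlt (by positivity)))

/-- Strict convexity of the `ℓ_p` norm for `1 < p < ∞`. -/
theorem PiLp.eq_of_two_le_norm_add [Fact (1 ≤ p)] (hp : 1 < p.toReal) {x y : PiLp p (fun _ : ι => ℝ)}
    (hx : ‖x‖ ≤ 1) (hy : ‖y‖ ≤ 1) (hxy : 2 ≤ ‖x + y‖) : x = y := by
  by_contra hne
  obtain ⟨i, hi⟩ : ∃ i, x i ≠ y i := by
    by_contra! hall
    exact hne (PiLp.ext hall)
  have hp0 : 0 < p.toReal := by linarith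
  have hlt : ∑ i, |(x i + y i) / 2| ^ p.toReal < 1 := by
    calc ∑ i, |(x i + y i) / 2| ^ p.toReal
        < ∑ i, (|x i| ^ p.toReal + |y i| ^ p.toReal) / 2 :=
          Finset.sum_lt_sum (fun i _ => abs_half_add_rpow_le hp _ _)
            ⟨i, Finset.mem_univ i, abs_half_add_rpow_lt hp hi⟩
      _ = (∑ i, |x i| ^ p.toReal + ∑ i, |y i| ^ p.toReal) / 2 := by
          rw [← Finset.sum_div, Finset.sum_add_distrib]
      _ ≤ 1 := by
          linarith [PiLp.sum_rpow_le_one hp0 hx, PiLp.sum_rpow_le_one hp0 hy]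
  have hhalf : ‖(1 / 2 : ℝ) • (x + y)‖ < 1 := by
    rw [PiLp.norm_eq_sum hp0]
    refine Real.rpow_lt_one (Finset.sum_nonneg fun i _ => Real.rpow_nonneg (norm_nonneg _) _) ?_
      (by positivity)
    refine lt_of_eq_of_lt (Finset.sum_congr rfl fun i _ => ?_) hlt
    rw [Real.norm_eq_abs, PiLp.smul_apply, PiLp.add_apply, smul_eq_mul]
    ring_nf
  rw [norm_smul, Real.norm_of_nonneg (by norm_num)] at hhalf
  linarith

/-- For `p < ∞` the metric space `K_{3,2}` does not embed isometrically into `ℓ_p`. -/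
theorem PiLp.exists_dist_lt_two [Fact (1 ≤ p)] (hp : p ≠ ⊤) (x₁ x₂ x₃ y₁ y₂ : PiLp p (fun _ : ι => ℝ))
    (h₁₁ : ‖x₁ - y₁‖ ≤ 1) (h₂₁ : ‖x₂ - y₁‖ ≤ 1) (h₃₁ : ‖x₃ - y₁‖ ≤ 1)
    (h₁₂ : ‖x₁ - y₂‖ ≤ 1) (h₂₂ : ‖x₂ - y₂‖ ≤ 1) (h₃₂ : ‖x₃ - y₂‖ ≤ 1)
    (hy : 2 ≤ ‖y₁ - y₂‖) : ‖x₁ - x₂‖ < 2 ∨ ‖x₁ - x₃‖ < 2 ∨ ‖x₂ - x₃‖ < 2 := by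
  by_contra! hx
  obtain ⟨hx₁₂, hx₁₃, hx₂₃⟩ := hx
  have hp1 : 1 ≤ p.toReal := by
    simpa using ENNReal.toReal_mono hp (Fact.out : 1 ≤ p)
  rcases hp1.eq_or_lt with hp1 | hp1
  · obtain rfl : p = 1 := by
      rw [← ENNReal.ofReal_toReal hp, ← hp1, ENNReal.ofReal_one]
    simp only [PiLp.norm_eq_of_L1, PiLp.sub_apply, Real.norm_eq_abs] at *
    -- Summed over the coordinates, the left side is at least `4 · 2` and the right side at most
    -- `6`.
    have := Finset.sum_le_sum fun i (_ : i ∈ Finset.univ) =>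
      abs_sub_pentagonal (x₁ i) (x₂ i) (x₃ i) (y₁ i) (y₂ i)
    simp only [Finset.sum_add_distrib] at this
    linarith
  -- Strict convexity makes `y₁` the midpoint of `x₁` and `x`, so `x₂` and `x₃` are the same
  -- reflection of `x₁`.
  · have key : ∀ x, ‖x - y₁‖ ≤ 1 → 2 ≤ ‖x₁ - x‖ → x₁ - y₁ = y₁ - x := fun x hx hx1 =>
      PiLp.eq_of_two_le_norm_add hp1 h₁₁ (by rwa [norm_sub_rev]) (by rwa [sub_add_sub_cancel])
    have h2 : x₂ = x₃ := sub_right_injective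
      ((key x₂ h₂₁ hx₁₂).symm.trans (key x₃ h₃₁ hx₁₃))
    rw [h2, sub_self, norm_zero] at hx₂₃
    norm_num at hx₂₃

end PiLp

theorem PiLp.exists_two_le_abs {ι : Type*} [Fintype ι] {x : PiLp ⊤ (fun _ : ι => ℝ)}
    (hx : 2 ≤ ‖x‖) : ∃ i, 2 ≤ |x i| := by
  rw [PiLp.norm_eq_ciSup] at hx
  by_contra! hlt
  rcases isEmpty_or_nonempty ι with hι | hι
  · rw [Real.iSup_of_isEmpty] at hx
    norm_num at hx
  · obtain ⟨i, hi⟩ := exists_eq_ciSup_of_finite (f := fun i => ‖x i‖)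
    rw [← hi] at hx
    exact absurd hx (not_le.mpr (hlt i))

/-- If each of `q` pairs of points is at `ℓ_∞` distance at least `2`, and any points of different
pairs are at distance at most `1`, then the dimension is at least `q`. -/
theorem PiLp.card_le_card_of_pairs {κ ι : Type*} [Fintype κ] [Fintype ι]
    (x y : κ → PiLp ⊤ (fun _ : ι => ℝ)) (hxy : ∀ i, 2 ≤ ‖x i - y i‖)
    (hxx : ∀ i j, i ≠ j → ‖x i - x j‖ ≤ 1) (hyx : ∀ i j, i ≠ j → ‖y i - x j‖ ≤ 1)
    (hyy : ∀ i j, i ≠ j → ‖y i - y j‖ ≤ 1) : Fintype.card κ ≤ Fintype.card ι := by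
  choose f hf using fun i => PiLp.exists_two_le_abs (hxy i)
  refine Fintype.card_le_of_injective f fun i j hij => ?_
  by_contra hne
  have hle : ∀ {z : PiLp ⊤ (fun _ : ι => ℝ)} (k : ι), ‖z‖ ≤ 1 → |z k| ≤ 1 := fun k hz =>
    (PiLp.norm_apply_le _ k).trans hz
  have h1 := hf i
  have h2 := hf j
  rw [← hij] at h2
  have h3 := hle (f i) (hxx i j hne)
  have h4 := hle (f i) (hyx i j hne)
  have h5 := hle (f i) (hyx j i (Ne.symm hne))
  have h6 := hle (f i) (hyy i j hne)
  simp only [PiLp.sub_apply, abs_le, le_abs] at h1 h2 h3 h4 h5 h6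
  -- If pairs `i` and `j` share a coordinate, their two gaps sum to at least `4` there, but also
  -- equal a sum of two cross differences, at most `2`.
  rcases h1 with h1 | h1 <;> rcases h2 with h2 | h2 <;> linarith

/-! ### Double counting -/

open Classical in
/-- A relation between the three parts of a complete tripartite graph that meets every triangle has
many edges. -/
theorem Finset.card_mul_card_mul_card_le {α : Type*} (P : α → α → Prop) (A B C : Finset α)
    (hP : ∀ a ∈ A, ∀ b ∈ B, ∀ c ∈ C, P a b ∨ P a c ∨ P b c) :
    A.card * B.card * C.card ≤
      ((A ×ˢ B).filter fun x => P x.1 x.2).card * C.card +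
      ((A ×ˢ C).filter fun x => P x.1 x.2).card * B.card +
      ((B ×ˢ C).filter fun x => P x.1 x.2).card * A.card := by
  -- Count triangles: each contains an edge of `P`, and an edge lies in as many triangles as the
  -- third part has vertices.
  have hsum : ∑ a ∈ A, ∑ b ∈ B, ∑ c ∈ C, 1 ≤ ∑ a ∈ A, ∑ b ∈ B, ∑ c ∈ C,
      ((if P a b then 1 else 0) + (if P a c then 1 else 0) + (if P b c then 1 else 0)) := by
    refine Finset.sum_le_sum fun a ha => Finset.sum_le_sum fun b hb =>
      Finset.sum_le_sum fun c hc => ?_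
    rcases hP a ha b hb c hc with h | h | h <;> simp only [h, if_true] <;> omega
  have e1 : ((A ×ˢ B).filter fun x => P x.1 x.2).card * C.card =
      ∑ a ∈ A, ∑ b ∈ B, ∑ _c ∈ C, if P a b then 1 else 0 := by
    simp only [Finset.card_filter, Finset.sum_product, Finset.sum_const,
      smul_eq_mul, mul_comm, Finset.mul_sum]
  have e2 : ((A ×ˢ C).filter fun x => P x.1 x.2).card * B.card =
      ∑ a ∈ A, ∑ _b ∈ B, ∑ c ∈ C, if P a c then 1 else 0 := by
    simp only [Finset.card_filter, Finset.sum_product, Finset.sum_const,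
      smul_eq_mul, mul_comm, Finset.mul_sum]
  have e3 : ((B ×ˢ C).filter fun x => P x.1 x.2).card * A.card =
      ∑ _a ∈ A, ∑ b ∈ B, ∑ c ∈ C, if P b c then 1 else 0 := by
    simp only [Finset.card_filter, Finset.sum_product, Finset.sum_const,
      smul_eq_mul, mul_comm]
  rw [e1, e2, e3]
  simp only [Finset.sum_add_distrib] at hsum
  refine le_trans (le_of_eq ?_) hsum
  simp [mul_assoc]

/-! ### The graph and its blow-up -/

/-- The complete multipartite graph with `q` parts of size `3` (its vertices carry the label
`true`), with a pendant vertex (with the label `false`) attached to each of its vertices. -/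
def pendantMultipartite (q : ℕ) : SimpleGraph (Fin q × Fin 3 × Bool) where
  Adj r r' := (r.2.2 = true ∧ r'.2.2 = true ∧ r.1 ≠ r'.1) ∨
    (r.1 = r'.1 ∧ r.2.1 = r'.2.1 ∧ r.2.2 ≠ r'.2.2)
  symm := ⟨by
    rintro r r' (⟨h1, h2, h3⟩ | ⟨h1, h2, h3⟩)
    · exact Or.inl ⟨h2, h1, h3.symm⟩
    · exact Or.inr ⟨h1.symm, h2.symm, h3.symm⟩⟩
  loopless := ⟨by
    rintro r (⟨-, -, h⟩ | ⟨-, -, h⟩) <;> exact h rfl⟩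

/-- A `1`-Lipschitz function on `pendantMultipartite q` that vanishes at the pendant vertex of the
vertex `(i, a)` and has the value `3` at the other vertices of part `i`. -/
def pendantPotential {q : ℕ} (i : Fin q) (a : Fin 3) (r : Fin q × Fin 3 × Bool) : ℕ :=
  if r.1 ≠ i then 2 else if r.2.1 ≠ a then 3 else if r.2.2 then 1 else 0

theorem pendantPotential_le_add_one {q : ℕ} (i : Fin q) (a : Fin 3)
    {r r' : Fin q × Fin 3 × Bool} (hr : (pendantMultipartite q).Adj r r') :
    pendantPotential i a r' ≤ pendantPotential i a r + 1 := by
  obtain ⟨j, b, x⟩ := r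
  obtain ⟨j', b', x'⟩ := r'
  rcases hr with ⟨h1, h2, h3⟩ | ⟨h1, h2, h3⟩
  · dsimp only at h1 h2 h3
    subst h1 h2
    simp only [pendantPotential, if_true]
    split_ifs <;> omega
  · dsimp only at h1 h2 h3
    subst h1 h2
    simp only [pendantPotential]
    split_ifs <;> omega

/-- Every vertex is within `1` of a core vertex, and two core vertices are within `2`: those of the
same part meet through another part, whence `2 ≤ q`. -/
theorem edist_comap_pendantMultipartite_le {V : Type*} {q : ℕ} (hq : 2 ≤ q)
    {ρ : V → Fin q × Fin 3 × Bool} (hρ : Function.Surjective ρ) (u v : V) :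
    ((pendantMultipartite q).comap ρ).edist u v ≤ 4 := by
  set G := (pendantMultipartite q).comap ρ with hG
  have hadj : ∀ {x y : V}, G.Adj x y → G.edist x y ≤ 1 := fun h =>
    (SimpleGraph.edist_eq_one_iff_adj.mpr h).le
  have hcore : ∀ v, ∃ w, (ρ w).2.2 = true ∧ G.edist v w ≤ 1 := by
    intro v
    rcases hv : (ρ v).2.2
    · obtain ⟨w, hw⟩ := hρ ((ρ v).1, (ρ v).2.1, true)
      refine ⟨w, by rw [hw], hadj (Or.inr ?_)⟩
      rw [hw, hv]
      simp
    · exact ⟨v, hv, by simp⟩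
  have hcores : ∀ w w', (ρ w).2.2 = true → (ρ w').2.2 = true → G.edist w w' ≤ 2 := by
    intro w w' hw hw'
    by_cases hne : (ρ w).1 = (ρ w').1
    · have : Nontrivial (Fin q) := Fin.nontrivial_iff_two_le.mpr hq
      obtain ⟨j, hj⟩ := exists_ne (ρ w).1
      obtain ⟨x, hx⟩ := hρ (j, 0, true)
      calc G.edist w w' ≤ G.edist w x + G.edist x w' := G.edist_triangle
        _ ≤ 1 + 1 := by
          refine add_le_add (hadj (Or.inl ⟨hw, by rw [hx], by rw [hx]; exact hj.symm⟩))
            (hadj (Or.inl ⟨by rw [hx], hw', ?_⟩))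
          rw [hx, ← hne]
          exact hj
        _ = 2 := one_add_one_eq_two
    · exact (hadj (Or.inl ⟨hw, hw', hne⟩)).trans one_le_two
  obtain ⟨w, hw, huw⟩ := hcore u
  obtain ⟨w', hw', hvw'⟩ := hcore v
  calc G.edist u v ≤ G.edist u w + G.edist w v := G.edist_triangle
    _ ≤ G.edist u w + (G.edist w w' + G.edist w' v) := by gcongr; exact G.edist_triangle
    _ ≤ 1 + (2 + 1) := by
      gcongr
      · exact hcores w w' hw hw'
      · rwa [SimpleGraph.edist_comm]
    _ = 4 := by norm_num

theorem SimpleGraph.connected_and_diam_le {V : Type*} [Nonempty V] {G : SimpleGraph V} {k : ℕ}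
    (hG : ∀ u v, G.edist u v ≤ k) : G.Connected ∧ G.diam ≤ k := by
  refine ⟨⟨fun u v => SimpleGraph.reachable_of_edist_ne_top
    (ne_top_of_le_ne_top (ENat.natCast_ne_top k) (hG u v))⟩, ?_⟩
  exact ENat.toNat_le_toNat (SimpleGraph.ediam_le_of_edist_le hG) (ENat.natCast_ne_top k)

/-- Residues modulo the size of `R` are equidistributed on `Fin n` up to rounding. -/
theorem exists_equitable_map (R : Type*) [Fintype R] [Nonempty R] [DecidableEq R] (n : ℕ) :
    ∃ ρ : Fin n → R, ∀ r, n / Fintype.card R ≤ (Finset.univ.filter fun v => ρ v = r).card := by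
  set N := Fintype.card R with hN
  have hpos : 0 < N := Fintype.card_pos
  let e : R ≃ Fin N := Fintype.equivFin R
  refine ⟨fun v => e.symm ⟨v % N, Nat.mod_lt _ hpos⟩, fun r => ?_⟩
  have hlt : ∀ j : Fin (n / N), (j : ℕ) * N + e r < n := by
    intro j
    have h1 : ((j : ℕ) + 1) * N ≤ n / N * N := Nat.mul_le_mul_right _ j.2
    have h2 := Nat.div_mul_le_self n N
    have h3 := (e r).2
    rw [add_one_mul] at h1
    omega
  conv_lhs => rw [← Fintype.card_fin (n / N), ← Finset.card_univ]
  refine Finset.card_le_card_of_injOn (fun j => ⟨j * N + e r, hlt j⟩) ?_ ?_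
  · intro j _
    simp only [Finset.coe_filter, Finset.mem_univ, true_and, Set.mem_ofPred_eq]
    rw [Equiv.symm_apply_eq]
    ext
    simp [Nat.mod_eq_of_lt (e r).2]
  · intro j _ j' _ hjj
    simp only [Fin.mk.injEq, add_left_inj] at hjj
    exact Fin.ext (Nat.eq_of_mul_eq_mul_right hpos hjj)

/-! ### Underestimated pairs and scanned vertices -/

section BlowUp

variable {V : Type*} [Fintype V] {q m : ℕ} {ρ : V → Fin q × Fin 3 × Bool}

open Classical in
/-- In a consistent norm heuristic on the blow-up, many pairs of vertices at distance `2` have an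
underestimated distance. -/
theorem exists_many_pairs_lt_two (hq : 2 ≤ q) (hm : 0 < m)
    (hρ : ∀ r, m ≤ (Finset.univ.filter fun v => ρ v = r).card)
    {p : ℝ≥0∞} (hp : 1 ≤ p) {d : ℕ} (hd : p = ⊤ → d < q) (π : V → PiLp p (fun _ : Fin d => ℝ))
    (hπ : ∀ u v, ((pendantMultipartite q).comap ρ).Adj u v → ‖π u - π v‖ ≤ 1) :
    ∃ i a b, a ≠ b ∧ m ^ 2 ≤ 3 * ((((Finset.univ.filter fun v => ρ v = (i, a, true)) ×ˢ
      (Finset.univ.filter fun v => ρ v = (i, b, true))).filter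
        fun x => ‖π x.1 - π x.2‖ < 2).card) := by
  set F : Fin q → Fin 3 → Finset V := fun i a => Finset.univ.filter fun v => ρ v = (i, a, true)
    with hF
  have hmem : ∀ {i a v}, v ∈ F i a ↔ ρ v = (i, a, true) := by simp [hF]
  have hcard : ∀ i a, m ≤ (F i a).card := fun i a => hρ _
  have hadj : ∀ {i j a b u v}, i ≠ j → u ∈ F i a → v ∈ F j b → ‖π u - π v‖ ≤ 1 := by
    intro i j a b u v hij hu hv
    refine hπ u v (Or.inl ?_)
    rw [hmem.mp hu, hmem.mp hv]
    exact ⟨rfl, rfl, hij⟩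
  have hall : ∀ i, (∀ u ∈ F i 0, ∀ v ∈ F i 1, ‖π u - π v‖ < 2) → ∃ i a b, a ≠ b ∧
      m ^ 2 ≤ 3 * (((F i a ×ˢ F i b).filter fun x => ‖π x.1 - π x.2‖ < 2).card) := by
    intro i hi
    refine ⟨i, 0, 1, by decide, ?_⟩
    rw [Finset.filter_true_of_mem fun x hx =>
      hi _ (Finset.mem_product.mp hx).1 _ (Finset.mem_product.mp hx).2, Finset.card_product]
    have := Nat.mul_le_mul (hcard i 0) (hcard i 1)
    nlinarith
  by_contra hcon
  have hfar : ∀ i, ∃ u ∈ F i 0, ∃ v ∈ F i 1, 2 ≤ ‖π u - π v‖ := by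
    intro i
    by_contra! hi
    exact hcon (hall i hi)
  by_cases htop : p = ⊤
  · subst htop
    choose x hx y hy hxy using hfar
    have := PiLp.card_le_card_of_pairs (fun i => π (x i)) (fun i => π (y i)) hxy
      (fun i j hij => hadj hij (hx i) (hx j)) (fun i j hij => hadj hij (hy i) (hx j))
      (fun i j hij => hadj hij (hy i) (hy j))
    simp only [Fintype.card_fin] at this
    exact absurd (hd rfl) (not_lt.mpr this)
  · have : Fact (1 ≤ p) := ⟨hp⟩
    let i : Fin q := ⟨0, by omega⟩
    let j : Fin q := ⟨1, by omega⟩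
    have hij : i ≠ j := by simp [i, j]
    obtain ⟨y₁, hy₁, y₂, hy₂, hy⟩ := hfar j
    -- The exact pair `y₁, y₂` of part `j` is the two-point side of a `K_{3,2}` whose other side is
    -- any transversal of part `i`.
    have htri := Finset.card_mul_card_mul_card_le (fun u v => ‖π u - π v‖ < 2)
      (F i 0) (F i 1) (F i 2) fun x₁ h₁ x₂ h₂ x₃ h₃ =>
        PiLp.exists_dist_lt_two htop (π x₁) (π x₂) (π x₃) (π y₁) (π y₂)
          (hadj hij h₁ hy₁) (hadj hij h₂ hy₁) (hadj hij h₃ hy₁)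
          (hadj hij h₁ hy₂) (hadj hij h₂ hy₂) (hadj hij h₃ hy₂) hy
    push Not at hcon
    have h01 := hcon i 0 1 (by decide)
    have h02 := hcon i 0 2 (by decide)
    have h12 := hcon i 1 2 (by decide)
    have hA := hcard i 0
    have hB := hcard i 1
    have hC := hcard i 2
    generalize (F i 0).card = A at *
    generalize (F i 1).card = B at *
    generalize (F i 2).card = C at *
    have e1 := Nat.mul_lt_mul_of_pos_right h01 (hm.trans_le hC)
    have e2 := Nat.mul_lt_mul_of_pos_right h02 (hm.trans_le hB)
    have e3 := Nat.mul_lt_mul_of_pos_right h12 (hm.trans_le hA)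
    -- With fewer than `m² / 3` pairs in each filter, the triangle count would be below `m² (A + B +
    -- C) / 3 ≤ A * B * C`.
    have f1 : m ^ 2 * C ≤ A * B * C := Nat.mul_le_mul_right _ (by nlinarith)
    have f2 : m ^ 2 * B ≤ A * C * B := Nat.mul_le_mul_right _ (by nlinarith)
    have f3 : m ^ 2 * A ≤ B * C * A := Nat.mul_le_mul_right _ (by nlinarith)
    rw [mul_right_comm A C B] at f2
    rw [mul_comm (B * C) A, ← mul_assoc] at f3
    linarith

/-- The total number of vertices that are scanned on the blow-up. -/
theorem pow_three_le_sum_card [DecidableEq V] (hq : 2 ≤ q) (hm : 0 < m)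
    (hρ : ∀ r, m ≤ (Finset.univ.filter fun v => ρ v = r).card)
    {p : ℝ≥0∞} (hp : 1 ≤ p) {d : ℕ} (hd : p = ⊤ → d < q) {h : V → V → ℝ}
    (hnorm : IsNormHeuristic p d h) (hh : IsConsistent ((pendantMultipartite q).comap ρ) h)
    {S : V → V → Finset V}
    (hS : ∀ s t, AStar.IsScannedSet ((pendantMultipartite q).comap ρ) h s t (S s t)) :
    m ^ 3 ≤ 3 * ∑ s, ∑ t, (S s t).card := by
  classical
  obtain ⟨π, hπ⟩ := hnorm
  obtain ⟨i, a, b, hab, hN⟩ := exists_many_pairs_lt_two hq hm hρ hp hd π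
    fun u v huv => hπ u v ▸ hh.le_one_of_adj huv
  set A := Finset.univ.filter fun v => ρ v = (i, a, true) with hA
  set B := Finset.univ.filter fun v => ρ v = (i, b, true) with hB
  set P := Finset.univ.filter fun v => ρ v = (i, a, false) with hP
  have hscan : ∀ s ∈ P, ∀ t ∈ B, (A.filter fun u => ‖π u - π t‖ < 2) ⊆ S s t := by
    intro s hs t ht u hu
    simp only [hA, hB, hP, Finset.mem_filter, Finset.mem_univ, true_and] at hs ht hu
    refine AStar.mem_of_isScannedSet (hS s t) hh
      (φ := fun v => pendantPotential i a (ρ v)) ?_ ?_ (u := u) ?_ ?_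
    · simp [hs, pendantPotential]
    · exact fun u v huv => pendantPotential_le_add_one i a huv
    · refine Or.inr ?_
      rw [hs, hu.1]
      simp
    · have h3 : pendantPotential i a (ρ t) = 3 := by simp [ht, pendantPotential, hab.symm]
      simp only [h3, hπ]
      push_cast
      linarith [hu.2]
  have hcount : ((A ×ˢ B).filter fun x => ‖π x.1 - π x.2‖ < 2).card =
      ∑ t ∈ B, (A.filter fun u => ‖π u - π t‖ < 2).card := by
    simp only [Finset.card_filter, Finset.sum_product_right]
  calc m ^ 3 = m * m ^ 2 := by ring
    _ ≤ P.card * (3 * ((A ×ˢ B).filter fun x => ‖π x.1 - π x.2‖ < 2).card) :=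
      Nat.mul_le_mul (hρ _) hN
    _ = 3 * ∑ s ∈ P, ∑ t ∈ B, (A.filter fun u => ‖π u - π t‖ < 2).card := by
      -- The set of vertices forced into `S s t` does not depend on `s ∈ P`.
      rw [Finset.sum_const, smul_eq_mul, hcount]
      ring
    _ ≤ 3 * ∑ s ∈ P, ∑ t ∈ B, (S s t).card := by
      gcongr with s hs t ht
      exact hscan s hs t ht
    _ ≤ 3 * ∑ s, ∑ t, (S s t).card := by
      refine Nat.mul_le_mul_left _ ?_
      exact (Finset.sum_le_sum fun s _ => Finset.sum_le_sum_of_subset (Finset.subset_univ B)).trans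
        (Finset.sum_le_sum_of_subset (Finset.subset_univ P))

end BlowUp

/-! ### Choice of parameters -/

theorem mainTheorem3 :
    ∃ (D k : ℕ) (c : ℝ) (G : (n : ℕ) → SimpleGraph (Fin n)),
      0 < c ∧
      (∀ n : ℕ, 0 < n → (G n).Connected ∧ (G n).diam ≤ D) ∧
      ∀ (p : ℝ≥0∞) (d : ℕ → ℕ), 1 ≤ p →
        (p ≠ ⊤ → (fun n : ℕ => (d n : ℝ)) =o[atTop] fun n : ℕ => (n : ℝ) / Real.log (n : ℝ)) →
        (p = ⊤ → (fun n : ℕ => (d n : ℝ)) =o[atTop] fun n : ℕ => Real.log (n : ℝ)) →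
        ∀ᶠ n : ℕ in atTop,
          ∀ h : Fin n → Fin n → ℝ, IsNormHeuristic p (d n) h → IsConsistent (G n) h →
            ∀ S : Fin n → Fin n → Finset (Fin n),
              (∀ s t : Fin n, AStar.IsScannedSet (G n) h s t (S s t)) →
                c * ((n : ℝ) / Real.log (n : ℝ) ^ k) ≤ averageCard S := by
  -- Large enough to exceed `d n` when `p = ∞`, yet only logarithmic; the `+ 2` also guarantees two
  -- parts.
  let q : ℕ → ℕ := fun n => ⌈Real.log n⌉₊ + 2
  have hq : ∀ n, 2 ≤ q n := fun n => Nat.le_add_left _ _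
  have : ∀ n, Nonempty (Fin (q n) × Fin 3 × Bool) := fun n =>
    ⟨(⟨0, Nat.succ_pos _⟩, 0, true)⟩
  choose ρ hρ using fun n => exists_equitable_map (Fin (q n) × Fin 3 × Bool) n
  have hcard : ∀ n, Fintype.card (Fin (q n) × Fin 3 × Bool) = 6 * q n := by
    intro n
    simp only [Fintype.card_prod, Fintype.card_fin, Fintype.card_bool]
    ring
  simp only [hcard] at hρ
  -- The exponent `3` comes from `m³` with `m ≈ n / log n`, and `41472 = 3 · 24³`. For small `n`
  -- some classes could be empty, so the complete graph is used instead.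
  refine ⟨4, 3, 1 / 41472, fun n => if 6 * q n ≤ n then (pendantMultipartite (q n)).comap (ρ n)
    else ⊤, by norm_num, fun n hn => ?_, fun p d hp _ hd => ?_⟩
  · have : Nonempty (Fin n) := ⟨⟨0, hn⟩⟩
    refine SimpleGraph.connected_and_diam_le fun u v => ?_
    dsimp only
    split_ifs with hqn
    · refine edist_comap_pendantMultipartite_le (hq n) (fun r => ?_) u v
      have hpos : 0 < n / (6 * q n) := Nat.div_pos hqn (by have := hq n; omega)
      obtain ⟨v, hv⟩ := Finset.card_pos.mp (hpos.trans_le (hρ n r))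
      exact ⟨v, (Finset.mem_filter.mp hv).2⟩
    · by_cases huv : u = v
      · simp [huv]
      · rw [SimpleGraph.edist_eq_one_iff_adj.mpr (show (⊤ : SimpleGraph (Fin n)).Adj u v from huv)]
        norm_num
  -- `1 / 12` gives `6 * q n ≤ 12 * log n ≤ n`.
  have hlog : ∀ᶠ n : ℕ in atTop, Real.log n ≤ 1 / 12 * n := by
    have h1 := (Real.isLittleO_log_id_atTop.comp_tendsto tendsto_natCast_atTop_atTop).bound
      (by norm_num : (0 : ℝ) < 1 / 12)
    filter_upwards [h1] with n hn
    simp only [Function.comp_apply, id, Real.norm_eq_abs, Nat.abs_cast] at hn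
    exact (le_abs_self _).trans hn
  -- `3` absorbs the rounding: `⌈log n⌉₊ + 2 < log n + 3 ≤ 2 * log n`.
  have hlarge : ∀ᶠ n : ℕ in atTop, 3 ≤ Real.log n :=
    (Real.tendsto_log_atTop.comp tendsto_natCast_atTop_atTop).eventually_ge_atTop 3
  have hdim : ∀ᶠ n : ℕ in atTop, p = ⊤ → d n < q n := by
    by_cases htop : p = ⊤
    · filter_upwards [(hd htop).bound one_pos, hlarge] with n hn h3 _
      rw [one_mul, Real.norm_eq_abs, Real.norm_eq_abs, Nat.abs_cast,
        abs_of_nonneg (by linarith)] at hn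
      have : d n ≤ ⌈Real.log n⌉₊ := by exact_mod_cast hn.trans (Nat.le_ceil _)
      simp only [q]
      omega
    · exact Eventually.of_forall fun n h => absurd h htop
  filter_upwards [hlog, hlarge, hdim] with n hlog hlarge hdim h hnorm hh S hS
  have hq2 : (q n : ℝ) ≤ 2 * Real.log n := by
    have := Nat.ceil_lt_add_one (show 0 ≤ Real.log n by linarith)
    simp only [q]
    push_cast
    linarith
  have hqn : 6 * q n ≤ n := by
    have : (6 * q n : ℝ) ≤ n := by linarith
    exact_mod_cast this
  simp only [if_pos hqn] at hh hS
  set m := n / (6 * q n) with hm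
  have hq0 : 0 < 6 * q n := by have := hq n; omega
  have hmpos : 0 < m := Nat.div_pos hqn hq0
  have hsum := pow_three_le_sum_card (hq n) hmpos (hρ n) hp hdim hnorm hh hS
  have hnm : (n : ℝ) ≤ 24 * Real.log n * m := by
    have h1 : n < 6 * q n * (m + 1) := by
      rw [hm]
      exact Nat.lt_mul_div_succ n hq0
    -- As `m ≥ 1`, the floor in `m` costs at most a factor `2`.
    have h2 : 6 * q n * (m + 1) ≤ 6 * q n * (2 * m) := Nat.mul_le_mul_left _ (by omega)
    have h3 : (n : ℝ) ≤ 6 * q n * (2 * m) := by exact_mod_cast h1.le.trans h2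
    have h4 : (q n : ℝ) * m ≤ 2 * Real.log n * m := by gcongr
    linarith
  have hlogpos : 0 < Real.log n := by linarith
  have hnpos : (0 : ℝ) < n := by
    have : 0 < n := by omega
    exact_mod_cast this
  have hsum' : (m : ℝ) ^ 3 ≤ 3 * ∑ s, ∑ t, ((S s t).card : ℝ) := by exact_mod_cast hsum
  rw [averageCard, Fintype.card_fin, le_div_iff₀ (by positivity)]
  have hn3 : (n : ℝ) ^ 3 ≤ (24 * Real.log n * m) ^ 3 := by gcongr
  have hm3 : (n : ℝ) ^ 3 / Real.log n ^ 3 ≤ 13824 * m ^ 3 := by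
    rw [div_le_iff₀ (by positivity)]
    linarith
  calc 1 / 41472 * (n / Real.log n ^ 3) * (n : ℝ) ^ 2
      = 1 / 41472 * ((n : ℝ) ^ 3 / Real.log n ^ 3) := by ring
    _ ≤ ∑ s, ∑ t, ((S s t).card : ℝ) := by linarith
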